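/- **Setting.** Let $T$ (primitive tests) and $\Sigma$ (actions) be finite sets. Tests are $b,c ::= 0\mid 1\mid t\in T\mid \bar b\mid b\wedge c\mid b\vee c$, programs are $e,f ::= b\mid p\in\Sigma\mid e\cdot f\mid e+_b f\mid e^{(b)}$; $\mathrm{Exp}$ is the set of programs. Tests are considered equivalent, $b\equiv c$, when this follows from the axioms of Boolean algebra. $A$ is the set of atoms (complete conjunctions of literals over $T$, i.e. sign assignments on $T$), and $a\in b$ means that the atom $a$ implies $b$. Put $E(b)=b$, $E(p)=0$, $E(e\cdot f)=E(e)\wedge E(f)$, $E(e+_bf)=(b\wedge E(e))\vee(\bar b\wedge E(f))$, $E(e^{(b)})=\bar b$; $e$ is *productive* if $E(e)\equiv 0$. **Axioms.** $\equiv$ is the least congruence on $\mathrm{Exp}$ that contains the equivalences of Boolean algebra between tests (also in guard positions) and satisfies U1 $e+_be\equiv e$; U2 $e+_bf\equiv f+_{\bar b}e$; U3 $(e+_bf)+_cg\equiv e+_{b\wedge c}(f+_cg)$; U4 $e+_bf\equiv b\cdot e+_bf$; U5 $e\cdot g+_bf\cdot g\equiv(e+_bf)\cdot g$; S1 $(e\cdot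 f)\cdot g\equiv e\cdot(f\cdot g)$; S2 $0\cdot e\equiv0$; S3 $e\cdot0\equiv0$; S4 $1\cdot e\equiv e$; S5 $e\equiv e\cdot1$; S6 $b\cdot c\equiv b\wedge c$; W1 $e^{(b)}\equiv e\cdot e^{(b)}+_b1$; W2 $(c\cdot e)^{(b)}\equiv(e+_c1)^{(b)}$; W3 if $e$ is productive and $g\equiv e\cdot g+_bf$, then $g\equiv e^{(b)}\cdot f$. $\equiv_0$ is the least such congruence when S3 is omitted. **Uniqueness axiom.** A *Salomaa system* consists of $n\in\mathbb N$ equations $x_i=e_{i1}\cdot x_1+_{b_{i1}}(\cdots+_{b_{i(n-1)}}(e_{in}\cdot x_n+_{b_{in}}c_i))$, $1\le i\le n$, with productive programs $e_{ij}$, and tests $b_{ij},c_i$ such that $b_{ij}\wedge b_{ik}\equiv0$ for $j\ne k$ and $c_i\wedge b_{ij}\equiv0$ for all $j$. For a congruence $\approx$ on $\mathrm{Exp}$, a *solution in $\mathrm{Exp}/{\approx}$* is a tuple $(g_i)$ of programs that satisfies all the equations up to $\approx$. The *uniqueness axiom for $\approx$* says that any two solutions $(g_i),(h_i)$ in $\mathrm{Exp}/{\approx}$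 of a Salomaa system satisfy $g_i\approx h_i$ for all $i$. **Trees.** $Z$ is the set of partial functions $t:A^+\rightharpoonup 2+\Sigma$ on non-empty words of atoms, defined on all one-letter words, such that if $t(w)\in\Sigma$ then $t$ is defined at $wa$ for all $a\in A$, and if $t(w)\in2=\{0,1\}$ then $t$ is undefined at all proper extensions of $w$. If $t(a)\in\Sigma$, put $\partial_at=\lambda w.\,t(aw)\in Z$. The semantics $[\![-]\!]:\mathrm{Exp}\to Z$ sends a test $b$ to the tree with $[\![b]\!](a)=1$ if $a\in b$ and $0$ otherwise, an action $p$ to the tree with $[\![p]\!](a)=p$, $\partial_a[\![p]\!]=[\![1]\!]$, and the program constructors to the operations on $Z$ uniquely determined by $(s\cdot t)(a)=t(a)$, $\partial_a(s\cdot t)=\partial_at$ if $s(a)=1$, and $(s\cdot t)(a)=s(a)$, $\partial_a(s\cdot t)=(\partial_as)\cdot t$ otherwise; $(s+_bt)(a)=s(a)$, $\partial_a(s+_bt)=\partial_as$ if $a\in b$, and $(s+_bt)(a)=t(a)$, $\partial_a(s+_bt)=\partial_at$ otherwise; $t^{(b)}(a)=1$ if $a\notin b$, $t^{(b)}(a)=t(a)$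 if $a\in b$ and $t(a)\in\Sigma$, $t^{(b)}(a)=0$ otherwise, and $\partial_a(t^{(b)})=(\partial_at)\cdot t^{(b)}$ (derivatives being prescribed where the label is in $\Sigma$). A tree is *dead* if it never takes the value $1$. Normalization $t\mapsto t^\wedge$ on $Z$ is determined by $t^\wedge(a)=0$ if $t(a)\in\Sigma$ and $\partial_at$ is dead, $t^\wedge(a)=t(a)$ otherwise, and $\partial_a(t^\wedge)=(\partial_at)^\wedge$. The normalized semantics is $[\![e]\!]^\wedge=([\![e]\!])^\wedge$. **Theorem (completeness for $\equiv$).** 1. Assume the uniqueness axiom for $\equiv$ and for $\equiv_0$. For all $e,f\in\mathrm{Exp}$, if $[\![e]\!]^\wedge=[\![f]\!]^\wedge$, then $e\equiv f$. 2. The same holds when the uniqueness axiom is added to the theory: if $\approx$ is any congruence on $\mathrm{Exp}$ that contains the Boolean equivalences of tests and satisfies all the axioms above (including S3) and the uniqueness axiom for $\approx$, then $[\![e]\!]^\wedge=[\![f]\!]^\wedge$ implies $e\approx f$. -/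

import Mathlib

namespace GKAT

/-- Tests (Boolean expressions) over the primitive tests `T`. -/
inductive BExp (T : Type*) where
  | zero : BExp T
  | one : BExp T
  | prim : T → BExp T
  | not : BExp T → BExp T
  | and : BExp T → BExp T → BExp T
  | or : BExp T → BExp T → BExp T

/-- Equivalence of tests: the congruence generated by the axioms of Boolean algebra. -/
inductive BEquiv {T : Type*} : BExp T → BExp T → Prop
  | refl (b : BExp T) : BEquiv b b
  | symm {b c : BExp T} : BEquiv b c → BEquiv c b
  | trans {b c d : BExp T} : BEquiv b c → BEquiv c d → BEquiv b d
  | not_congr {b b' : BExp T} : BEquiv b b' → BEquiv b.not b'.not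
  | and_congr {b b' c c' : BExp T} :
      BEquiv b b' → BEquiv c c' → BEquiv (b.and c) (b'.and c')
  | or_congr {b b' c c' : BExp T} :
      BEquiv b b' → BEquiv c c' → BEquiv (b.or c) (b'.or c')
  | and_comm (b c : BExp T) : BEquiv (b.and c) (c.and b)
  | or_comm (b c : BExp T) : BEquiv (b.or c) (c.or b)
  | and_assoc (b c d : BExp T) : BEquiv ((b.and c).and d) (b.and (c.and d))
  | or_assoc (b c d : BExp T) : BEquiv ((b.or c).or d) (b.or (c.or d))
  | and_or (b c : BExp T) : BEquiv (b.and (b.or c)) b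
  | or_and (b c : BExp T) : BEquiv (b.or (b.and c)) b
  | and_distrib (b c d : BExp T) : BEquiv (b.and (c.or d)) ((b.and c).or (b.and d))
  | or_distrib (b c d : BExp T) : BEquiv (b.or (c.and d)) ((b.or c).and (b.or d))
  | and_one (b : BExp T) : BEquiv (b.and BExp.one) b
  | or_zero (b : BExp T) : BEquiv (b.or BExp.zero) b
  | and_not (b : BExp T) : BEquiv (b.and b.not) BExp.zero
  | or_not (b : BExp T) : BEquiv (b.or b.not) BExp.one

/-- Atoms: an atom `d₁ ∧ ⋯ ∧ d_l` with `dᵢ ∈ {tᵢ, t̄ᵢ}` is given by the choice of a sign for every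
primitive test. -/
abbrev Atom (T : Type*) := T → Bool

/-- `b.eval a = true` is the relation `a ∈ b` (the atom `a` implies the test `b`). -/
def BExp.eval {T : Type*} : BExp T → Atom T → Bool
  | .zero, _ => false
  | .one, _ => true
  | .prim t, a => a t
  | .not b, a => !(b.eval a)
  | .and b c, a => b.eval a && c.eval a
  | .or b c, a => b.eval a || c.eval a

/-- Programs over the primitive tests `T` and the actions `Act`. -/
inductive Exp (T Act : Type*) where
  | test : BExp T → Exp T Act
  | act : Act → Exp T Act
  | seq : Exp T Act → Exp T Act → Exp T Act
  /-- `ite b e f` is `e +_b f`. -/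
  | ite : BExp T → Exp T Act → Exp T Act → Exp T Act
  /-- `loop b e` is `e^(b)`. -/
  | loop : BExp T → Exp T Act → Exp T Act

/-- The immediate-acceptance test `E(e)`. -/
def Exp.E {T Act : Type*} : Exp T Act → BExp T
  | .test b => b
  | .act _ => .zero
  | .seq e f => .and e.E f.E
  | .ite b e f => .or (.and b e.E) (.and (.not b) f.E)
  | .loop b _ => .not b

/-- `e` is productive if `E(e) ≡ 0`. -/
def Exp.Productive {T Act : Type*} (e : Exp T Act) : Prop := BEquiv e.E .zero

open Exp in
/-- `R` is a congruence on programs that contains the Boolean-algebra equivalences of tests and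
satisfies all axioms of guarded Kleene algebra with tests, with the possible exception of the
early-termination axiom `e · 0 ≡ 0`. -/
structure IsReducedCongruence {T Act : Type*} (R : Exp T Act → Exp T Act → Prop) : Prop where
  equivalence : Equivalence R
  test_congr : ∀ {b c : BExp T}, BEquiv b c → R (test b) (test c)
  seq_congr : ∀ {e e' f f' : Exp T Act}, R e e' → R f f' → R (seq e f) (seq e' f')
  ite_congr : ∀ {b b' : BExp T} {e e' f f' : Exp T Act},
    BEquiv b b' → R e e' → R f f' → R (ite b e f) (ite b' e' f')
  loop_congr : ∀ {b b' : BExp T} {e e' : Exp T Act},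
    BEquiv b b' → R e e' → R (loop b e) (loop b' e')
  U1 : ∀ b e, R (ite b e e) e
  U2 : ∀ b e f, R (ite b e f) (ite b.not f e)
  U3 : ∀ b c e f g, R (ite c (ite b e f) g) (ite (b.and c) e (ite c f g))
  U4 : ∀ b e f, R (ite b e f) (ite b (seq (test b) e) f)
  U5 : ∀ b e f g, R (ite b (seq e g) (seq f g)) (seq (ite b e f) g)
  S1 : ∀ e f g, R (seq (seq e f) g) (seq e (seq f g))
  S2 : ∀ e, R (seq (test .zero) e) (test .zero)
  S4 : ∀ e, R (seq (test .one) e) e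
  S5 : ∀ e, R e (seq e (test .one))
  S6 : ∀ b c, R (seq (test b) (test c)) (test (b.and c))
  W1 : ∀ b e, R (loop b e) (ite b (seq e (loop b e)) (test .one))
  W2 : ∀ b c e, R (loop b (seq (test c) e)) (loop b (ite c e (test .one)))
  W3 : ∀ b e f g, e.Productive → R g (ite b (seq e g) f) → R g (seq (loop b e) f)

/-- `R` is a congruence on programs that satisfies all axioms, including early termination. -/
structure IsCongruence {T Act : Type*} (R : Exp T Act → Exp T Act → Prop) : Prop
    extends IsReducedCongruence R where
  S3 : ∀ e, R (.seq e (.test .zero)) (.test .zero)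

/-- The reduced congruence `≡₀`: the least congruence satisfying the axioms without `S3`. -/
def Equiv₀ {T Act : Type*} (e f : Exp T Act) : Prop :=
  ∀ R : Exp T Act → Exp T Act → Prop, IsReducedCongruence R → R e f

/-- The congruence `≡`: the least congruence satisfying all axioms. -/
def Equiv {T Act : Type*} (e f : Exp T Act) : Prop :=
  ∀ R : Exp T Act → Exp T Act → Prop, IsCongruence R → R e f

theorem isReducedCongruence_equiv₀ {T Act : Type*} :
    IsReducedCongruence (Equiv₀ (T := T) (Act := Act)) where
  equivalence := ⟨fun _ _ h => h.equivalence.refl _,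
    fun h R hR => hR.equivalence.symm (h R hR),
    fun h h' R hR => hR.equivalence.trans (h R hR) (h' R hR)⟩
  test_congr h _ hR := hR.test_congr h
  seq_congr h h' R hR := hR.seq_congr (h R hR) (h' R hR)
  ite_congr hb h h' R hR := hR.ite_congr hb (h R hR) (h' R hR)
  loop_congr hb h R hR := hR.loop_congr hb (h R hR)
  U1 _ _ _ hR := hR.U1 _ _
  U2 _ _ _ _ hR := hR.U2 _ _ _
  U3 _ _ _ _ _ _ hR := hR.U3 _ _ _ _ _
  U4 _ _ _ _ hR := hR.U4 _ _ _
  U5 _ _ _ _ _ hR := hR.U5 _ _ _ _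
  S1 _ _ _ _ hR := hR.S1 _ _ _
  S2 _ _ hR := hR.S2 _
  S4 _ _ hR := hR.S4 _
  S5 _ _ hR := hR.S5 _
  S6 _ _ _ hR := hR.S6 _ _
  W1 _ _ _ hR := hR.W1 _ _
  W2 _ _ _ _ hR := hR.W2 _ _ _
  W3 _ _ _ _ he h R hR := hR.W3 _ _ _ _ he (h R hR)

theorem isCongruence_equiv {T Act : Type*} : IsCongruence (Equiv (T := T) (Act := Act)) where
  equivalence := ⟨fun _ _ h => h.equivalence.refl _,
    fun h R hR => hR.equivalence.symm (h R hR),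
    fun h h' R hR => hR.equivalence.trans (h R hR) (h' R hR)⟩
  test_congr h _ hR := hR.test_congr h
  seq_congr h h' R hR := hR.seq_congr (h R hR) (h' R hR)
  ite_congr hb h h' R hR := hR.ite_congr hb (h R hR) (h' R hR)
  loop_congr hb h R hR := hR.loop_congr hb (h R hR)
  U1 _ _ _ hR := hR.U1 _ _
  U2 _ _ _ _ hR := hR.U2 _ _ _
  U3 _ _ _ _ _ _ hR := hR.U3 _ _ _ _ _
  U4 _ _ _ _ hR := hR.U4 _ _ _
  U5 _ _ _ _ _ hR := hR.U5 _ _ _ _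
  S1 _ _ _ _ hR := hR.S1 _ _ _
  S2 _ _ hR := hR.S2 _
  S3 _ _ hR := hR.S3 _
  S4 _ _ hR := hR.S4 _
  S5 _ _ hR := hR.S5 _
  S6 _ _ _ hR := hR.S6 _ _
  W1 _ _ _ hR := hR.W1 _ _
  W2 _ _ _ _ hR := hR.W2 _ _ _
  W3 _ _ _ _ he h R hR := hR.W3 _ _ _ _ he (h R hR)

/-- A system of `n` left-affine equations
`xᵢ = eᵢ₁ · x₁ +_{bᵢ₁} (⋯ +_{bᵢ₍ₙ₋₁₎} (eᵢₙ · xₙ +_{bᵢₙ} cᵢ))`. -/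
structure AffineSystem (T Act : Type*) (n : ℕ) where
  coeff : Fin n → Fin n → Exp T Act
  guard : Fin n → Fin n → BExp T
  const : Fin n → BExp T
  guard_disjoint : ∀ i j k, j ≠ k → BEquiv ((guard i j).and (guard i k)) .zero
  const_disjoint : ∀ i j, BEquiv ((const i).and (guard i j)) .zero

namespace AffineSystem

variable {T Act : Type*} {n : ℕ}

/-- The right-hand side of the `i`-th equation, with `g` substituted for the indeterminates. -/
def rhs (S : AffineSystem T Act n) (g : Fin n → Exp T Act) (i : Fin n) : Exp T Act :=
  (List.finRange n).foldr (fun j r => .ite (S.guard i j) (.seq (S.coeff i j) (g j)) r)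
    (.test (S.const i))

/-- `g` is a solution in `Exp / R`. -/
def IsSolution (S : AffineSystem T Act n) (R : Exp T Act → Exp T Act → Prop)
    (g : Fin n → Exp T Act) : Prop :=
  ∀ i, R (g i) (S.rhs g i)

/-- A system is Salomaa if all its coefficients are productive. -/
def IsSalomaa (S : AffineSystem T Act n) : Prop :=
  ∀ i j, (S.coeff i j).Productive

end AffineSystem

/-- The uniqueness axiom for `R`: every Salomaa system has at most one solution in `Exp / R`. -/
def UniquenessAxiom {T Act : Type*} (R : Exp T Act → Exp T Act → Prop) : Prop :=
  ∀ (n : ℕ) (S : AffineSystem T Act n), S.IsSalomaa →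
    ∀ g h : Fin n → Exp T Act, S.IsSolution R g → S.IsSolution R h → ∀ i, R (g i) (h i)

/-- Trees: partial functions `t : A⁺ ⇀ 2 + Act` (written as partial functions on all words that are
undefined at the empty word), defined on all one-letter words, such that `wa` is in the domain
whenever `t w` is an action, and no proper extension of `w` is in the domain if `t w ∈ 2`.
Here `inl true` is acceptance and `inl false` is rejection. -/
@[ext]
structure Tree (T Act : Type*) where
  val : List (Atom T) → Option (Bool ⊕ Act)
  val_nil : val [] = none
  val_atom : ∀ a, (val [a]).isSome
  val_act : ∀ w p a, val w = some (.inr p) → (val (w ++ [a])).isSome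
  val_leaf : ∀ w o x, val w = some (.inl o) → x ≠ [] → val (w ++ x) = none

/-- A GKAT-automaton with state space `X`: a transition function `X × A → 2 + Act × X`. -/
abbrev Automaton (T Act X : Type*) := X → Atom T → Bool ⊕ Act × X

namespace Tree

variable {T Act X : Type*}

/-- The label `t(a)` at an atom. -/
def head (t : Tree T Act) (a : Atom T) : Bool ⊕ Act := (t.val [a]).get (t.val_atom a)

theorem val_singleton (t : Tree T Act) (a : Atom T) : t.val [a] = some (t.head a) := by
  simp [head]

/-- The subtree `∂_a t = λ w. t(aw)`, defined when `t(a)` is an action. -/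
def deriv (t : Tree T Act) (a : Atom T) (p : Act) (h : t.head a = .inr p) : Tree T Act where
  val w := if w = [] then none else t.val (a :: w)
  val_nil := by simp
  val_atom b := by
    have := t.val_act [a] p b (by rw [val_singleton, h])
    simpa using this
  val_act w q b hw := by
    rcases w with _ | ⟨c, w⟩
    · simp at hw
    · have := t.val_act (a :: c :: w) q b (by simpa using hw)
      simpa using this
  val_leaf w o x hw hx := by
    rcases w with _ | ⟨c, w⟩
    · simp at hw
    · have := t.val_leaf (a :: c :: w) o x (by simpa using hw) hx
      simpa using this

/-- The transition function of the final automaton, whose states are the trees. -/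
def step : Automaton T Act (Tree T Act) := fun t a =>
  match h : t.head a with
  | .inl o => .inl o
  | .inr p => .inr (p, t.deriv a p h)

/-- The labels read off along a word by running an automaton from a given state. -/
def unfoldVal (δ : Automaton T Act X) : X → List (Atom T) → Option (Bool ⊕ Act)
  | _, [] => none
  | x, [a] => some ((δ x a).map id Prod.fst)
  | x, a :: b :: w =>
    match δ x a with
    | .inl _ => none
    | .inr (_, y) => unfoldVal δ y (b :: w)

/-- The behaviour of a state of an automaton, as a tree. -/
def unfold (δ : Automaton T Act X) (x : X) : Tree T Act where
  val := unfoldVal δ x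
  val_nil := rfl
  val_atom a := by simp [unfoldVal]
  val_act w p a h := by
    induction w generalizing x with
    | nil => simp [unfoldVal] at h
    | cons b w ih =>
      rcases w with _ | ⟨c, w⟩
      · rcases hd : δ x b with o | ⟨q, y⟩
        · simp [unfoldVal, hd] at h
        · simp [unfoldVal, hd]
      · rcases hd : δ x b with o | ⟨q, y⟩
        · simp [unfoldVal, hd] at h
        · simp only [unfoldVal, hd, List.cons_append] at h ⊢
          exact ih y h
  val_leaf w o u h hu := by
    induction w generalizing x with
    | nil => simp [unfoldVal] at h
    | cons b w ih =>
      rcases w with _ | ⟨c, w⟩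
      · rcases u with _ | ⟨d, u⟩
        · exact absurd rfl hu
        · rcases hd : δ x b with o' | ⟨q, y⟩
          · simp [unfoldVal, hd]
          · simp [unfoldVal, hd] at h
      · rcases hd : δ x b with o' | ⟨q, y⟩
        · simp [unfoldVal, hd] at h
        · simp only [unfoldVal, hd, List.cons_append] at h ⊢
          exact ih y h

theorem step_of_head_inl {t : Tree T Act} {a : Atom T} {o : Bool} (h : t.head a = .inl o) :
    t.step a = .inl o := by
  unfold step
  split <;> rename_i h' <;> rw [h] at h' <;> simp_all

theorem step_of_head_inr {t : Tree T Act} {a : Atom T} {p : Act} (h : t.head a = .inr p) :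
    t.step a = .inr (p, t.deriv a p h) := by
  unfold step
  split <;> rename_i q h' <;> have h'' := h.symm.trans h'
  · simp at h''
  · obtain rfl : p = q := by simpa using h''
    rfl

/-- Behaviour is a homomorphism to the final automaton. -/
theorem step_unfold (δ : Automaton T Act X) (x : X) (a : Atom T) :
    (unfold δ x).step a = (δ x a).map id (Prod.map id (unfold δ)) := by
  have hh : (unfold δ x).head a = (δ x a).map id Prod.fst := by
    simp [head, unfold, unfoldVal]
  rcases hd : δ x a with o | ⟨p, y⟩
  · rw [step_of_head_inl (o := o) (by simp [hh, hd])]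
    simp
  · rw [step_of_head_inr (p := p) (by simp [hh, hd])]
    simp only [Sum.map_inr, Prod.map_apply, id, Sum.inr.injEq, Prod.mk.injEq, true_and]
    ext1
    funext w
    rcases w with _ | ⟨b, w⟩
    · simp [deriv, unfold, unfoldVal]
    · simp [deriv, unfold, unfoldVal, hd]

/-- The tree of a test. -/
def test (b : BExp T) : Tree T Act :=
  unfold (X := Unit) (fun _ a => .inl (b.eval a)) ()

/-- The tree of an action `p`: perform `p`, then terminate successfully (state `true` is the initial
one). -/
def act (p : Act) : Tree T Act :=
  unfold (X := Bool) (fun x _ => if x then .inr (p, false) else .inl true) true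

/-- Sequential composition. In state `inl s'` the automaton still executes `s'`, a subtree of `s`;
in state `inr t'` it has moved on to `t'`, a subtree of `t`. -/
def seq (s t : Tree T Act) : Tree T Act :=
  unfold (X := Tree T Act ⊕ Tree T Act) (fun x a =>
    match x with
    | .inl s' =>
      match s'.step a with
      | .inl true => (t.step a).map id (Prod.map id .inr)
      | .inl false => .inl false
      | .inr (p, s'') => .inr (p, .inl s'')
    | .inr t' => (t'.step a).map id (Prod.map id .inr)) (.inl s)

/-- Guarded union `s +_b t`. The state `none` is the initial one. -/
def ite (b : BExp T) (s t : Tree T Act) : Tree T Act :=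
  unfold (X := Option (Tree T Act)) (fun x a =>
    match x with
    | none => ((if b.eval a then s else t).step a).map id (Prod.map id some)
    | some u => (u.step a).map id (Prod.map id some)) none

/-- Guarded iteration `t^(b)`. The state `none` is the initial one, and the state `some s` behaves
as `s · t^(b)`. -/
def loop (b : BExp T) (t : Tree T Act) : Tree T Act :=
  unfold (X := Option (Tree T Act)) (fun x a =>
    let init : Bool ⊕ Act × Option (Tree T Act) :=
      if b.eval a then
        match t.step a with
        | .inl _ => .inl false
        | .inr (p, t') => .inr (p, some t')
      else .inl true
    match x with
    | none => init
    | some s =>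
      match s.step a with
      | .inl true => init
      | .inl false => .inl false
      | .inr (p, s') => .inr (p, some s')) none

/-- A tree is dead if it has no accepting leaf. -/
def Dead (t : Tree T Act) : Prop := ∀ w, t.val w ≠ some (.inl true)

open Classical in
/-- Normalization `t^∧`: prune every branch that leads to a dead subtree. -/
noncomputable def norm (t : Tree T Act) : Tree T Act :=
  unfold (X := Tree T Act) (fun t a =>
    match t.step a with
    | .inl o => .inl o
    | .inr (p, t') => if t'.Dead then .inl false else .inr (p, t')) t

/-- Coinduction: bisimilar trees coincide. -/
theorem eq_of_bisim (R : Tree T Act → Tree T Act → Prop)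
    (hR : ∀ s t, R s t → ∀ a,
      (∃ o, s.step a = .inl o ∧ t.step a = .inl o) ∨
      ∃ p s' t', s.step a = .inr (p, s') ∧ t.step a = .inr (p, t') ∧ R s' t')
    {s t : Tree T Act} (h : R s t) : s = t := by
  have key : ∀ (u : Tree T Act) (a : Atom T) (w : List (Atom T)), u.val (a :: w) =
      match u.step a with
      | .inl o => if w = [] then some (.inl o) else none
      | .inr (p, u') => if w = [] then some (.inr p) else u'.val w := by
    intro u a w
    rcases hu : u.head a with o | p
    · rw [step_of_head_inl hu]
      rcases w with _ | ⟨b, w⟩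
      · simp [val_singleton, hu]
      · simpa using u.val_leaf [a] o (b :: w) (by rw [val_singleton, hu]) (by simp)
    · rw [step_of_head_inr hu]
      rcases w with _ | ⟨b, w⟩
      · simp [val_singleton, hu]
      · simp [deriv]
  ext1
  funext w
  induction w generalizing s t with
  | nil => rw [s.val_nil, t.val_nil]
  | cons a w ih =>
    rw [key s, key t]
    rcases hR s t h a with ⟨o, h1, h2⟩ | ⟨p, s', t', h1, h2, h3⟩
    · rw [h1, h2]
    · rw [h1, h2]
      simp only [ih h3]

/-- An equality of transitions, which covers all cases of a bisimulation that end in equality. -/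
theorem step_cases (s t : Tree T Act) (a : Atom T) (h : s.step a = t.step a)
    (R : Tree T Act → Tree T Act → Prop) (hR : ∀ u, R u u) :
    (∃ o, s.step a = .inl o ∧ t.step a = .inl o) ∨
      ∃ p s' t', s.step a = .inr (p, s') ∧ t.step a = .inr (p, t') ∧ R s' t' := by
  rcases h' : s.step a with o | ⟨p, u⟩
  · exact .inl ⟨o, rfl, by rw [← h, h']⟩
  · exact .inr ⟨p, u, u, rfl, by rw [← h, h'], hR u⟩

/-- A state whose transitions are copied from trees behaves as the tree. -/
theorem unfold_eq_of_copy (δ : Automaton T Act X) (i : Tree T Act → X)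
    (h : ∀ u a, δ (i u) a = (u.step a).map id (Prod.map id i)) (u : Tree T Act) :
    unfold δ (i u) = u := by
  refine eq_of_bisim (fun s t => s = unfold δ (i t)) ?_ rfl
  rintro _ u rfl a
  rcases hu : u.step a with o | ⟨p, u'⟩
  · exact .inl ⟨o, by simp [step_unfold, h, hu], rfl⟩
  · exact .inr ⟨p, unfold δ (i u'), u', by simp [step_unfold, h, hu], rfl, rfl⟩

/-! The behavioural differential equations that characterize the operations. -/

theorem step_test (b : BExp T) (a : Atom T) :
    (test b : Tree T Act).step a = .inl (b.eval a) := by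
  simp [test, step_unfold]

theorem step_act (p : Act) (a : Atom T) :
    (act p : Tree T Act).step a = .inr (p, test .one) := by
  simp only [act, step_unfold, if_true, Sum.map_inr, Prod.map_apply, id, Sum.inr.injEq,
    Prod.mk.injEq, true_and]
  refine eq_of_bisim (fun s t => ∀ a, s.step a = .inl true ∧ t.step a = .inl true)
    (fun s t h a => .inl ⟨true, h a⟩) (fun a => ?_)
  simp [step_unfold, step_test, BExp.eval]

theorem step_seq (s t : Tree T Act) (a : Atom T) :
    (seq s t).step a =
      match s.step a with
      | .inl true => t.step a
      | .inl false => .inl false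
      | .inr (p, s') => .inr (p, seq s' t) := by
  simp only [seq, step_unfold]
  rcases hs : s.step a with (_ | _) | ⟨p, s'⟩
  · simp
  · simp only []
    rcases ht : t.step a with o | ⟨p, t'⟩
    · simp
    · simp only [Sum.map_inr, Prod.map_apply, id, Sum.inr.injEq, Prod.mk.injEq, true_and]
      exact unfold_eq_of_copy _ Sum.inr (fun u a => rfl) t'
  · simp

theorem step_ite (b : BExp T) (s t : Tree T Act) (a : Atom T) :
    (ite b s t).step a = if b.eval a then s.step a else t.step a := by
  simp only [ite, step_unfold]
  rw [← apply_ite (fun u : Tree T Act => u.step a)]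
  rcases (if b.eval a then s else t).step a with o | ⟨p, u⟩
  · simp
  · simp only [Sum.map_inr, Prod.map_apply, id, Sum.inr.injEq, Prod.mk.injEq, true_and]
    exact unfold_eq_of_copy _ some (fun u a => rfl) u

theorem step_loop (b : BExp T) (t : Tree T Act) (a : Atom T) :
    (loop b t).step a =
      if b.eval a then
        match t.step a with
        | .inl _ => .inl false
        | .inr (p, t') => .inr (p, seq t' (loop b t))
      else .inl true := by
  set δ : Automaton T Act (Option (Tree T Act)) := fun x a =>
    let init : Bool ⊕ Act × Option (Tree T Act) :=
      if b.eval a then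
        match t.step a with
        | .inl _ => .inl false
        | .inr (p, t') => .inr (p, some t')
      else .inl true
    match x with
    | none => init
    | some s =>
      match s.step a with
      | .inl true => init
      | .inl false => .inl false
      | .inr (p, s') => .inr (p, some s') with hδ
  have hl : loop b t = unfold δ none := rfl
  have hs : ∀ s, unfold δ (some s) = seq s (loop b t) := by
    intro s
    refine eq_of_bisim (fun x y => x = y ∨ ∃ s, x = unfold δ (some s) ∧ y = seq s (loop b t)) ?_
      (.inr ⟨s, rfl, rfl⟩)
    rintro x y (rfl | ⟨s, rfl, rfl⟩) a
    · exact step_cases _ _ _ rfl _ (fun u => .inl rfl)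
    · rcases h : s.step a with (_ | _) | ⟨p, s'⟩
      · exact .inl ⟨false, by simp [step_unfold, hδ, h], by simp [step_seq, h]⟩
      · refine step_cases _ _ _ ?_ _ (fun u => .inl rfl)
        rw [step_seq, h, hl, step_unfold, step_unfold]
        simp [hδ, h]
      · exact .inr ⟨p, unfold δ (some s'), seq s' (loop b t), by simp [step_unfold, hδ, h],
          by simp [step_seq, h], .inr ⟨s', rfl, rfl⟩⟩
  rw [hl, step_unfold, ← hl]
  by_cases hb : b.eval a
  · rcases h : t.step a with o | ⟨p, t'⟩
    · simp [hδ, hb, h]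
    · simp only [← hs]
      simp [hδ, hb, h]
  · simp [hδ, hb]

open Classical in
theorem step_norm (t : Tree T Act) (a : Atom T) :
    t.norm.step a =
      match t.step a with
      | .inl o => .inl o
      | .inr (p, t') => if t'.Dead then .inl false else .inr (p, t'.norm) := by
  unfold norm
  rw [step_unfold]
  rcases t.step a with o | ⟨p, t'⟩
  · simp
  · by_cases h : t'.Dead <;> simp [h]

end Tree

/-- The tree semantics `⟦e⟧`. -/
def Exp.sem {T Act : Type*} : Exp T Act → Tree T Act
  | .test b => Tree.test b
  | .act p => Tree.act p
  | .seq e f => Tree.seq e.sem f.sem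
  | .ite b e f => Tree.ite b e.sem f.sem
  | .loop b e => Tree.loop b e.sem

/-- The normalized semantics `⟦e⟧^∧`. -/
noncomputable def Exp.normSem {T Act : Type*} (e : Exp T Act) : Tree T Act := e.sem.norm

end GKAT

/-! Fix a congruence `R` that satisfies all axioms and its own uniqueness axiom. Statements about
programs are checked atom by atom: `R e f` follows once `a · e` and `a · f` are related for every
atom `a` (`of_forall_atom`). This replaces large guarded sums over atoms.

Every program has syntactic derivatives that compute its tree, and only finitely many programs are
reached by iterating them (`exists_finite_closed`). The fundamental theorem `atom_seq_ofStep` says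
that, at `a`, a program equals `1`, `0` or `p · e'`, according to its derivative; it does not need
`S3`. A finite automaton is a Salomaa system, so the uniqueness axiom becomes a coinduction
principle: two families of programs that follow the transitions of the same finite automaton agree
(`eq_of_uniqueness`).

This principle is used twice. On the dead derivatives of a program, the identity and the constant
family `0` both follow the transitions, the latter by `S3`; so dead programs are equivalent to `0`
(`zero_of_dead`), and pruning dead branches is provably sound. On the pairs of derivatives of `e`
and `f` with equal normalized semantics, both projections follow the transitions after pruning; so
`e` and `f` are related. -/

namespace GKAT

/-! ### Boolean algebra from the axioms -/

namespace BEquiv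

variable {T : Type*}

instance : Trans (BEquiv (T := T)) BEquiv BEquiv := ⟨BEquiv.trans⟩

/-- Two absorption laws combine: `b ∧ (b ∨ (b ∧ b))` is `b` by one, and its second factor is `b` by
the other. -/
theorem and_self (b : BExp T) : BEquiv (b.and b) b :=
  (and_congr (refl b) (or_and b b).symm).trans (and_or b _)

theorem or_self (b : BExp T) : BEquiv (b.or b) b :=
  (or_congr (refl b) (and_or b b).symm).trans (or_and b _)

theorem and_zero (b : BExp T) : BEquiv (b.and .zero) .zero :=
  calc BEquiv _ (b.and (b.and b.not)) := and_congr (refl b) (and_not b).symm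
    BEquiv _ ((b.and b).and b.not) := (and_assoc b b b.not).symm
    BEquiv _ (b.and b.not) := and_congr (and_self b) (refl _)
    BEquiv _ .zero := and_not b

theorem zero_or (b : BExp T) : BEquiv (BExp.zero.or b) b :=
  (or_comm _ _).trans (or_zero b)

theorem one_and (b : BExp T) : BEquiv (BExp.one.and b) b :=
  (and_comm _ _).trans (and_one b)

theorem and_not_of_le {x b : BExp T} (h : BEquiv (x.and b) x) : BEquiv (x.and b.not) .zero :=
  calc BEquiv (x.and b.not) ((x.and b).and b.not) := and_congr h.symm (refl _)
    BEquiv _ (x.and (b.and b.not)) := and_assoc _ _ _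
    BEquiv _ (x.and .zero) := and_congr (refl x) (and_not b)
    BEquiv _ .zero := and_zero x

theorem and_not_of_disjoint {x b : BExp T} (h : BEquiv (x.and b) .zero) :
    BEquiv (x.and b.not) x :=
  calc BEquiv (x.and b.not) (BExp.zero.or (x.and b.not)) := (zero_or _).symm
    BEquiv _ ((x.and b).or (x.and b.not)) := or_congr h.symm (refl _)
    BEquiv _ (x.and (b.or b.not)) := (and_distrib _ _ _).symm
    BEquiv _ (x.and .one) := and_congr (refl x) (or_not b)
    BEquiv _ x := and_one x

/-- Case distinction along a test. -/
theorem and_congr_of_cases {x b c : BExp T} (t : BExp T)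
    (h : BEquiv ((x.and t).and b) ((x.and t).and c))
    (h' : BEquiv ((x.and t.not).and b) ((x.and t.not).and c)) :
    BEquiv (x.and b) (x.and c) := by
  have key (d : BExp T) :
      BEquiv (x.and d) (((x.and t).and d).or ((x.and t.not).and d)) :=
    calc BEquiv (x.and d) (d.and x) := and_comm _ _
      BEquiv _ (d.and (x.and .one)) := and_congr (refl d) (and_one x).symm
      BEquiv _ (d.and (x.and (t.or t.not))) :=
        and_congr (refl d) (and_congr (refl x) (or_not t).symm)
      BEquiv _ (d.and ((x.and t).or (x.and t.not))) := and_congr (refl d) (and_distrib _ _ _)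
      BEquiv _ ((d.and (x.and t)).or (d.and (x.and t.not))) := and_distrib _ _ _
      BEquiv _ (((x.and t).and d).or ((x.and t.not).and d)) :=
        or_congr (and_comm _ _) (and_comm _ _)
  exact (key b).trans ((or_congr h h').trans (key c).symm)

end BEquiv

/-! ### Atoms and completeness of the Boolean axioms -/

namespace BExp

variable {T : Type*}

/-- The conjunction of the literals that the atom `a` selects for the primitive tests in a list. -/
def conj (a : Atom T) : List T → BExp T
  | [] => .one
  | t :: l => (conj a l).and (if a t then .prim t else (prim t).not)

theorem conj_congr {a c : Atom T} {l : List T} (h : ∀ t ∈ l, a t = c t) :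
    conj a l = conj c l := by
  induction l with
  | nil => rfl
  | cons t l ih =>
    simp only [List.mem_cons, forall_eq_or_imp] at h
    simp [conj, ih h.2, h.1]

theorem eval_conj {a c : Atom T} {l : List T} :
    (conj a l).eval c = true ↔ ∀ t ∈ l, c t = a t := by
  induction l with
  | nil => simp [conj, eval]
  | cons t l ih =>
    rcases h : a t <;> simp [conj, eval, ih, h, _root_.and_comm]

theorem conj_and_literal {a : Atom T} {l : List T} {t : T} (ht : t ∈ l) :
    BEquiv ((conj a l).and (if a t then .prim t else (prim t).not)) (conj a l) := by
  induction l with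
  | nil => simp at ht
  | cons u l ih =>
    rcases List.mem_cons.1 ht with rfl | ht
    · exact (BEquiv.and_assoc _ _ _).trans (.and_congr (.refl _) (BEquiv.and_self _))
    · calc BEquiv _ _ := BEquiv.and_assoc _ _ _
        BEquiv _ _ := .and_congr (.refl _) (BEquiv.and_comm _ _)
        BEquiv _ _ := (BEquiv.and_assoc _ _ _).symm
        BEquiv _ _ := .and_congr (ih ht) (.refl _)

/-- A property that is stable under case distinctions along primitive tests holds globally if it
holds under all conjunctions of literals. -/
theorem of_forall_conj {P : BExp T → Prop}
    (hP : ∀ b t, P (b.and (.prim t)) → P (b.and (prim t).not) → P b) {l : List T} (hl : l.Nodup)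
    (h : ∀ a, P (conj a l)) : P .one := by
  classical
  induction l with
  | nil => exact h fun _ => true
  | cons t l ih =>
    rw [List.nodup_cons] at hl
    -- Each branch resets the sign of `t` in `a`. Since `t` does not occur in `l`, this leaves the
    -- conjunction over `l` unchanged.
    refine ih hl.2 fun a => hP _ t ?_ ?_
    · rw [conj_congr (c := Function.update a t true)]
      · simpa [conj] using h (Function.update a t true)
      · exact fun u hu => (Function.update_of_ne (ne_of_mem_of_not_mem hu hl.1) _ _).symm
    · rw [conj_congr (c := Function.update a t false)]
      · simpa [conj] using h (Function.update a t false)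
      · exact fun u hu => (Function.update_of_ne (ne_of_mem_of_not_mem hu hl.1) _ _).symm

variable [Fintype T]

/-- The test that holds at the atom `a` only. -/
noncomputable def ofAtom (a : Atom T) : BExp T := conj a Finset.univ.toList

theorem eval_ofAtom {a c : Atom T} : (ofAtom a).eval c = true ↔ c = a := by
  simp [ofAtom, eval_conj, funext_iff]

/-- Stands in for writing `1` as the disjunction of all atoms. With `P` abstract it serves both
tests and programs under a test. -/
theorem of_forall_ofAtom {P : BExp T → Prop}
    (hP : ∀ b t, P (b.and (.prim t)) → P (b.and (prim t).not) → P b)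
    (h : ∀ a, P (ofAtom a)) : P .one :=
  of_forall_conj hP (Finset.nodup_toList _) h

/-- An atom provably decides every test. For a primitive test the atom contains either the literal,
which is absorbed, or its negation, which gives a contradiction; the connectives follow by
induction. -/
theorem ofAtom_and (a : Atom T) (b : BExp T) :
    BEquiv ((ofAtom a).and b) (if b.eval a then ofAtom a else .zero) := by
  induction b with
  | zero => simpa [eval] using BEquiv.and_zero _
  | one => simpa [eval] using BEquiv.and_one _
  | prim t =>
    have h := conj_and_literal (a := a) (Finset.mem_toList.2 (Finset.mem_univ t))
    rcases ha : a t with _ | _ <;> simp only [ha, eval] at h ⊢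
    · calc BEquiv _ _ := .and_congr h.symm (.refl _)
        BEquiv _ _ := BEquiv.and_assoc _ _ _
        BEquiv _ _ := .and_congr (.refl _) (BEquiv.and_comm _ _)
        BEquiv _ _ := .and_congr (.refl _) (BEquiv.and_not _)
        BEquiv _ _ := BEquiv.and_zero _
    · exact h
  | not b ih =>
    rcases hb : b.eval a with _ | _ <;> simp only [hb, eval] at ih ⊢
    · exact BEquiv.and_not_of_disjoint ih
    · exact BEquiv.and_not_of_le ih
  | and b c ihb ihc =>
    refine (BEquiv.and_assoc _ _ _).symm.trans ((BEquiv.and_congr ihb (.refl _)).trans ?_)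
    rcases hb : b.eval a with _ | _ <;> simp only [hb, eval] at ihb ⊢
    · exact (BEquiv.and_comm _ _).trans (BEquiv.and_zero _)
    · exact ihc
  | or b c ihb ihc =>
    refine (BEquiv.and_distrib _ _ _).trans ((BEquiv.or_congr ihb ihc).trans ?_)
    rcases hb : b.eval a with _ | _ <;> rcases hc : c.eval a with _ | _ <;>
      simp only [hb, hc, eval]
    · exact BEquiv.or_zero _
    · exact BEquiv.zero_or _
    · exact BEquiv.or_zero _
    · exact BEquiv.or_self _

/-- Tests that hold at the same atoms are equivalent. -/
theorem bEquiv_of_eval {b c : BExp T} (h : ∀ a, b.eval a = c.eval a) : BEquiv b c := by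
  have key : BEquiv (BExp.one.and b) (BExp.one.and c) :=
    of_forall_ofAtom (P := fun x => BEquiv (x.and b) (x.and c))
      (fun _ t => BEquiv.and_congr_of_cases (.prim t))
      (fun a => (ofAtom_and a b).trans (h a ▸ (ofAtom_and a c).symm))
  exact (BEquiv.one_and b).symm.trans (key.trans (BEquiv.one_and c))

/-- Every set of atoms is described by a test. -/
theorem exists_eval_eq (p : Atom T → Bool) : ∃ b : BExp T, ∀ a, b.eval a = p a := by
  classical
  have key (l : List (Atom T)) :
      ∃ b : BExp T, ∀ a, b.eval a = true ↔ a ∈ l ∧ p a = true := by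
    induction l with
    | nil => exact ⟨.zero, by simp [eval]⟩
    | cons c l ih =>
      obtain ⟨b, hb⟩ := ih
      rcases hc : p c with _ | _
      · refine ⟨b, fun a => ?_⟩
        rw [hb, List.mem_cons]
        constructor
        · exact fun h => ⟨.inr h.1, h.2⟩
        · rintro ⟨rfl | h, h'⟩
          · simp [hc] at h'
          · exact ⟨h, h'⟩
      · refine ⟨(ofAtom c).or b, fun a => ?_⟩
        rw [List.mem_cons, eval, Bool.or_eq_true, eval_ofAtom, hb]
        constructor
        · rintro (rfl | h)
          · exact ⟨.inl rfl, hc⟩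
          · exact ⟨.inr h.1, h.2⟩
        · rintro ⟨rfl | h, h'⟩
          · exact .inl rfl
          · exact .inr ⟨h, h'⟩
  obtain ⟨b, hb⟩ := key Finset.univ.toList
  exact ⟨b, fun a => Bool.eq_iff_iff.2 (by simp [hb])⟩

end BExp

/-! ### Consequences of the axioms; reasoning at an atom -/

namespace IsReducedCongruence

open Exp

variable {T Act : Type*} {R : Exp T Act → Exp T Act → Prop}

theorem refl (hR : IsReducedCongruence R) (e : Exp T Act) : R e e := hR.equivalence.refl e

theorem symm (hR : IsReducedCongruence R) {e f : Exp T Act} (h : R e f) : R f e :=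
  hR.equivalence.symm h

theorem trans (hR : IsReducedCongruence R) {e f g : Exp T Act} (h : R e f) (h' : R f g) : R e g :=
  hR.equivalence.trans h h'

/-- By `U4` and `S2` the left branch can be replaced by `0`, so it is irrelevant; taking it to be
`f` reduces the claim to `U1`. -/
theorem ite_zero (hR : IsReducedCongruence R) (e f : Exp T Act) : R (ite .zero e f) f := by
  have key (g : Exp T Act) : R (ite .zero g f) (ite .zero (test .zero) f) :=
    hR.trans (hR.U4 _ _ _) (hR.ite_congr (.refl _) (hR.S2 _) (hR.refl _))
  exact hR.trans (key e) (hR.trans (hR.symm (key f)) (hR.U1 _ _))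

theorem test_seq_test_seq (hR : IsReducedCongruence R) (b c : BExp T) (e : Exp T Act) :
    R (seq (test b) (seq (test c) e)) (seq (test (b.and c)) e) :=
  hR.trans (hR.symm (hR.S1 _ _ _)) (hR.seq_congr (hR.S6 _ _) (hR.refl _))

theorem test_seq_disjoint (hR : IsReducedCongruence R) {b c : BExp T}
    (h : BEquiv (b.and c) .zero) (e : Exp T Act) :
    R (seq (test b) (seq (test c) e)) (test .zero) :=
  hR.trans (hR.test_seq_test_seq _ _ _)
    (hR.trans (hR.seq_congr (hR.test_congr h) (hR.refl _)) (hR.S2 _))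

variable [Fintype T]

/-- The right branch of a guarded union may assume that the guard fails. -/
theorem ite_not_seq (hR : IsReducedCongruence R) (b : BExp T) (e f : Exp T Act) :
    R (ite b e f) (ite b e (seq (test b.not) f)) := by
  let _ : Trans R R R := ⟨hR.trans⟩
  calc R (ite b e f) (ite b.not f e) := hR.U2 _ _ _
    R _ (ite b.not (seq (test b.not) f) e) := hR.U4 _ _ _
    R _ (ite b.not.not e (seq (test b.not) f)) := hR.U2 _ _ _
    R _ (ite b e (seq (test b.not) f)) := hR.ite_congr
      (BExp.bEquiv_of_eval (by simp [BExp.eval])) (hR.refl _) (hR.refl _)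

/-- The test `b` equals `1 +_b 0`, and `U5` distributes `e` over this union. Prefixing a test
thereby becomes a guarded union, to which `U3` applies. -/
theorem seq_test (hR : IsReducedCongruence R) (b : BExp T) (e : Exp T Act) :
    R (seq (test b) e) (ite b e (test .zero)) := by
  let _ : Trans R R R := ⟨hR.trans⟩
  have h : R (test b) (ite b (test .one) (test .zero)) := calc
    R (test b) (ite b (test b) (test b)) := hR.symm (hR.U1 _ _)
    R _ (ite b (test b) (seq (test b.not) (test b))) := hR.ite_not_seq _ _ _
    R _ (ite b (seq (test b) (test .one)) (test .zero)) := hR.ite_congr (.refl _) (hR.S5 _)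
      (hR.trans (hR.S6 _ _) (hR.test_congr ((BEquiv.and_comm _ _).trans (BEquiv.and_not b))))
    R _ (ite b (test .one) (test .zero)) := hR.symm (hR.U4 _ _ _)
  calc R (seq (test b) e) (seq (ite b (test .one) (test .zero)) e) := hR.seq_congr h (hR.refl _)
    R _ (ite b (seq (test .one) e) (seq (test .zero) e)) := hR.symm (hR.U5 _ _ _ _)
    R _ (ite b e (test .zero)) := hR.ite_congr (.refl _) (hR.S4 _) (hR.S2 _)

theorem test_seq_ite (hR : IsReducedCongruence R) (b c : BExp T) (e f : Exp T Act) :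
    R (seq (test b) (ite c e f)) (ite (c.and b) e (seq (test b) f)) := by
  let _ : Trans R R R := ⟨hR.trans⟩
  calc R (seq (test b) (ite c e f)) (ite b (ite c e f) (test .zero)) := hR.seq_test _ _
    R _ (ite (c.and b) e (ite b f (test .zero))) := hR.U3 _ _ _ _ _
    R _ (ite (c.and b) e (seq (test b) f)) :=
      hR.ite_congr (.refl _) (hR.refl _) (hR.symm (hR.seq_test _ _))

/-- After `test_seq_ite` the guard is `c ∧ a`, which is `a` or `0` because the atom decides `c`. -/
theorem atom_seq_ite (hR : IsReducedCongruence R) (a : Atom T) (c : BExp T) (e f : Exp T Act) :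
    R (seq (test (.ofAtom a)) (ite c e f))
      (seq (test (.ofAtom a)) (if c.eval a then e else f)) := by
  let _ : Trans R R R := ⟨hR.trans⟩
  have h := (BEquiv.and_comm c _).trans (BExp.ofAtom_and a c)
  refine hR.trans (hR.test_seq_ite _ _ _ _)
    (hR.trans (hR.ite_congr h (hR.refl _) (hR.refl _)) ?_)
  rcases c.eval a with _ | _
  · simpa using hR.ite_zero _ _
  · simp only [if_true]
    calc R _ _ := hR.ite_not_seq _ _ _
      R _ _ := hR.ite_congr (.refl _) (hR.refl _)
        (hR.test_seq_disjoint ((BEquiv.and_comm _ _).trans (BEquiv.and_not _)) _)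
      R _ _ := hR.symm (hR.seq_test _ _)

/-- At an atom, a test reduces to its truth value. -/
theorem atom_seq_test (hR : IsReducedCongruence R) (a : Atom T) (b : BExp T) :
    R (seq (test (.ofAtom a)) (test b))
      (seq (test (.ofAtom a)) (test (if b.eval a then .one else .zero))) := by
  refine hR.trans (hR.S6 _ _) (hR.symm (hR.trans (hR.S6 _ _) (hR.test_congr ?_)))
  refine BExp.bEquiv_of_eval fun c => ?_
  by_cases hc : c = a
  · subst hc
    cases h : b.eval c <;> simp [BExp.eval, h]
  · have : (BExp.ofAtom a).eval c = false :=
      Bool.eq_false_iff.2 fun h => hc (BExp.eval_ofAtom.1 h)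
    simp [BExp.eval, this]

theorem atom_seq_test_seq (hR : IsReducedCongruence R) (a : Atom T) (b : BExp T)
    (e : Exp T Act) : R (seq (test (.ofAtom a)) (seq (test b) e))
      (seq (test (.ofAtom a)) (if b.eval a then e else test .zero)) := by
  refine hR.trans (hR.test_seq_test_seq _ _ _)
    (hR.trans (hR.seq_congr (hR.test_congr (BExp.ofAtom_and a b)) (hR.refl _)) ?_)
  rcases b.eval a with _ | _
  · simp only [Bool.false_eq_true, if_false]
    exact hR.trans (hR.S2 _) (hR.symm (hR.trans (hR.S6 _ _) (hR.test_congr (BEquiv.and_zero _))))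
  · exact hR.refl _

/-- Programs that agree under the assumption of every atom are equivalent. -/
theorem of_forall_atom (hR : IsReducedCongruence R) {e f : Exp T Act}
    (h : ∀ a, R (seq (test (.ofAtom a)) e) (seq (test (.ofAtom a)) f)) : R e f := by
  have key : R (seq (test .one) e) (seq (test .one) f) := by
    refine BExp.of_forall_ofAtom (P := fun x => R (seq (test x) e) (seq (test x) f))
      (fun b t h h' => ?_) h
    -- The union of two copies of `b · g` is introduced by `U1`; each branch then absorbs its side
    -- of the case distinction.
    have split (g : Exp T Act) : R (seq (test b) g)
        (ite (.prim t) (seq (test (b.and (.prim t))) g)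
          (seq (test (b.and (BExp.prim t).not)) g)) := by
      let _ : Trans R R R := ⟨hR.trans⟩
      have swap (c : BExp T) :
          R (seq (test c) (seq (test b) g)) (seq (test (b.and c)) g) :=
        hR.trans (hR.test_seq_test_seq _ _ _)
          (hR.seq_congr (hR.test_congr (BEquiv.and_comm _ _)) (hR.refl _))
      calc R _ _ := hR.symm (hR.U1 (.prim t) _)
        R _ _ := hR.ite_not_seq _ _ _
        R _ _ := hR.U4 _ _ _
        R _ _ := hR.ite_congr (.refl _) (swap _) (swap _)
    exact hR.trans (split e) (hR.trans (hR.ite_congr (.refl _) h h') (hR.symm (split f)))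
  exact hR.trans (hR.symm (hR.S4 e)) (hR.trans key (hR.S4 f))

end IsReducedCongruence

/-! ### Syntactic derivatives -/

namespace Exp

variable {T Act : Type*}

/-- The syntactic derivatives of programs. -/
def step : Automaton T Act (Exp T Act)
  | .test b, a => .inl (b.eval a)
  | .act p, _ => .inr (p, .test .one)
  | .seq e f, a =>
    match e.step a with
    | .inl true => f.step a
    | .inl false => .inl false
    | .inr (p, e') => .inr (p, .seq e' f)
  | .ite b e f, a => if b.eval a then e.step a else f.step a
  | .loop b e, a =>
    if b.eval a then
      match e.step a with
      | .inl _ => .inl false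
      | .inr (p, e') => .inr (p, .seq e' (.loop b e))
    else .inl true

/-- The semantics is a homomorphism from the automaton of derivatives to the final automaton of
trees. -/
theorem step_sem (e : Exp T Act) (a : Atom T) :
    e.sem.step a = (e.step a).map id (Prod.map id sem) := by
  induction e with
  | test b => simp [sem, step, Tree.step_test]
  | act p => simp [sem, step, Tree.step_act]
  | seq e f ihe ihf =>
    rw [sem, Tree.step_seq, ihe, step]
    rcases e.step a with (_ | _) | ⟨p, e'⟩ <;> simp [ihf, sem]
  | ite b e f ihe ihf =>
    rw [sem, Tree.step_ite, ihe, ihf, step]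
    split_ifs <;> rfl
  | loop b e ih =>
    rw [sem, Tree.step_loop, ih, step]
    split_ifs
    · rcases e.step a with _ | ⟨p, e'⟩ <;> simp [sem]
    · rfl

theorem eval_E_iff {e : Exp T Act} {a : Atom T} : e.E.eval a = true ↔ e.step a = .inl true := by
  induction e with
  | test b => simp [E, step]
  | act p => simp [E, step, BExp.eval]
  | seq e f ihe ihf =>
    rw [E, BExp.eval, Bool.and_eq_true, ihe, ihf, step]
    rcases e.step a with (_ | _) | ⟨p, e'⟩ <;> simp
  | ite b e f ihe ihf =>
    simp only [E, BExp.eval, Bool.or_eq_true, Bool.and_eq_true, ihe, ihf, step]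
    cases b.eval a <;> simp
  | loop b e ih =>
    simp only [E, BExp.eval, step]
    cases b.eval a
    · simp
    · rcases e.step a with _ | ⟨p, e'⟩ <;> simp

/-- A program is contained in a finite set of programs that is closed under derivatives. -/
theorem exists_finite_closed (e : Exp T Act) : ∃ C : Set (Exp T Act), C.Finite ∧ e ∈ C ∧
    ∀ f ∈ C, ∀ a p f', f.step a = .inr (p, f') → f' ∈ C := by
  induction e with
  | test b => exact ⟨{.test b}, by simp, by simp, by simp [step]⟩
  | act p => exact ⟨{.act p, .test .one}, by simp, by simp, by simp [step]⟩
  | seq e f ihe ihf =>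
    obtain ⟨C, hC, heC, hstepC⟩ := ihe
    obtain ⟨D, hD, hfD, hstepD⟩ := ihf
    -- A run of `e · f` stays in some `e' · f` until `e'` accepts, and then moves among derivatives
    -- of `f`.
    refine ⟨(fun e' => .seq e' f) '' C ∪ D, (hC.image _).union hD,
      .inl ⟨e, heC, rfl⟩, ?_⟩
    rintro _ (⟨e', he', rfl⟩ | hg) a p g' h
    · rcases he : e'.step a with (_ | _) | ⟨q, e''⟩ <;> simp only [step, he] at h
      · simp at h
      · exact .inr (hstepD f hfD a p g' h)
      · obtain ⟨rfl, rfl⟩ : q = p ∧ seq e'' f = g' := by simpa using h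
        exact .inl ⟨e'', hstepC e' he' a _ _ he, rfl⟩
    · exact .inr (hstepD _ hg a p g' h)
  | ite b e f ihe ihf =>
    obtain ⟨C, hC, heC, hstepC⟩ := ihe
    obtain ⟨D, hD, hfD, hstepD⟩ := ihf
    refine ⟨{.ite b e f} ∪ (C ∪ D), (Set.finite_singleton _).union (hC.union hD), .inl rfl, ?_⟩
    rintro _ (rfl | hg | hg) a p g' h
    · rw [step] at h
      split_ifs at h
      · exact .inr (.inl (hstepC e heC a p g' h))
      · exact .inr (.inr (hstepD f hfD a p g' h))
    · exact .inr (.inl (hstepC _ hg a p g' h))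
    · exact .inr (.inr (hstepD _ hg a p g' h))
  | loop b e ih =>
    obtain ⟨C, hC, heC, hstepC⟩ := ih
    refine ⟨{.loop b e} ∪ (fun e' => .seq e' (.loop b e)) '' C,
      (Set.finite_singleton _).union (hC.image _), .inl rfl, ?_⟩
    -- Needed twice: for the loop itself, and for `e' · e^(b)` when `e'` accepts and the loop
    -- restarts. No deeper nesting of products arises.
    have key : ∀ a p g', (loop b e).step a = .inr (p, g') →
        g' ∈ (fun e' => seq e' (.loop b e)) '' C := by
      intro a p g' h
      rw [step] at h
      split_ifs at h
      rcases he : e.step a with o | ⟨q, e''⟩ <;> simp only [he] at h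
      · simp at h
      · obtain ⟨rfl, rfl⟩ : q = p ∧ seq e'' (.loop b e) = g' := by simpa using h
        exact ⟨e'', hstepC e heC a _ _ he, rfl⟩
    rintro _ (rfl | ⟨e', he', rfl⟩) a p g' h
    · exact .inr (key a p g' h)
    · rcases he : e'.step a with (_ | _) | ⟨q, e''⟩ <;> simp only [step, he] at h
      · simp at h
      · exact .inr (key a p g' h)
      · obtain ⟨rfl, rfl⟩ : q = p ∧ seq e'' (.loop b e) = g' := by simpa using h
        exact .inr ⟨e'', hstepC e' he' a _ _ he, rfl⟩

/-- The program described by the value of a transition function. -/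
def ofStep : Bool ⊕ Act × Exp T Act → Exp T Act
  | .inl true => .test .one
  | .inl false => .test .zero
  | .inr (p, e) => .seq (.act p) e

end Exp

/-! ### Fundamental theorem and coinduction from uniqueness -/

namespace IsReducedCongruence

open Exp

variable {T Act : Type*} [Fintype T] {R : Exp T Act → Exp T Act → Prop}

/-- The fundamental theorem: at every atom, a program is determined by its derivative. -/
theorem atom_seq_ofStep (hR : IsReducedCongruence R) (e : Exp T Act) (a : Atom T) :
    R (seq (test (.ofAtom a)) e) (seq (test (.ofAtom a)) (ofStep (e.step a))) := by
  have congr_seq {e₁ e₂ : Exp T Act} {a : Atom T} (g : Exp T Act)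
      (h : R (seq (test (.ofAtom a)) e₁) (seq (test (.ofAtom a)) e₂)) :
      R (seq (test (.ofAtom a)) (seq e₁ g)) (seq (test (.ofAtom a)) (seq e₂ g)) :=
    hR.trans (hR.symm (hR.S1 _ _ _)) (hR.trans (hR.seq_congr h (hR.refl _)) (hR.S1 _ _ _))
  induction e generalizing a with
  | test b =>
    have := hR.atom_seq_test a b
    rw [step]
    cases h : b.eval a <;> simpa [ofStep, h] using this
  | act p => exact hR.seq_congr (hR.refl _) (hR.S5 _)
  | seq e f ihe ihf =>
    refine hR.trans (congr_seq f (ihe a)) ?_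
    rcases he : e.step a with (_ | _) | ⟨p, e'⟩ <;> simp only [step, he, ofStep]
    · exact hR.seq_congr (hR.refl _) (hR.S2 _)
    · exact hR.trans (hR.seq_congr (hR.refl _) (hR.S4 _)) (ihf a)
    · exact hR.seq_congr (hR.refl _) (hR.S1 _ _ _)
  | ite b e f ihe ihf =>
    refine hR.trans (hR.atom_seq_ite _ _ _ _) ?_
    rw [step]
    split_ifs
    · exact ihe a
    · exact ihf a
  | loop b e ih =>
    -- Where `e` accepts at once, unfolding by `W1` would only return the loop itself. So the body
    -- is made productive first: `e` equals `1` on `E(e)`, hence `e` is `e +_c 1` with `c` the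
    -- negation of `E(e)`, and `W2` turns the body into `c · e`.
    have hprod : R (loop b e) (loop b (seq (test e.E.not) e)) := by
      refine hR.trans (hR.loop_congr (.refl _) ?_) (hR.symm (hR.W2 _ _ _))
      refine hR.of_forall_atom fun c => hR.symm (hR.trans (hR.atom_seq_ite _ _ _ _) ?_)
      by_cases hc : e.E.eval c = true
      · have := ih c
        rw [eval_E_iff.1 hc] at this
        simpa [BExp.eval, hc, ofStep] using hR.symm this
      · simpa [BExp.eval, hc] using hR.refl _
    have hunfold : R (loop b e) (ite b (seq (seq (test e.E.not) e) (loop b e)) (test .one)) :=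
      hR.trans hprod (hR.trans (hR.W1 _ _)
        (hR.ite_congr (.refl _) (hR.seq_congr (hR.refl _) (hR.symm hprod)) (hR.refl _)))
    refine hR.trans (hR.seq_congr (hR.refl _) hunfold) (hR.trans (hR.atom_seq_ite _ _ _ _) ?_)
    by_cases hb : b.eval a = true
    · have h1 := congr_seq (loop b e) (hR.atom_seq_test_seq a e.E.not e)
      simp only [step, hb, if_true]
      refine hR.trans h1 ?_
      -- If the body accepts immediately, the factor `c` makes it `0`, in agreement with the
      -- rejecting label of the loop. Otherwise `c` holds at `a` and the induction hypothesis
      -- applies.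
      rcases he : e.step a with (_ | _) | ⟨p, e'⟩
      · have hE : e.E.eval a = false := by simpa [he] using (eval_E_iff (e := e) (a := a)).not
        have h2 := congr_seq (loop b e) (ih a)
        simp only [he, ofStep] at h2
        simpa [BExp.eval, hE, ofStep] using hR.trans h2 (hR.seq_congr (hR.refl _) (hR.S2 _))
      · have hE : e.E.eval a = true := eval_E_iff.2 he
        simpa [BExp.eval, hE, ofStep] using hR.seq_congr (hR.refl _) (hR.S2 _)
      · have hE : e.E.eval a = false := by simpa [he] using (eval_E_iff (e := e) (a := a)).not
        have h2 := congr_seq (loop b e) (ih a)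
        simp only [he, ofStep] at h2
        simpa [BExp.eval, hE, ofStep] using hR.trans h2 (hR.seq_congr (hR.refl _) (hR.S1 _ _ _))
    · simpa [step, hb, ofStep] using hR.refl _

/-- At an atom, a cascade of guarded unions reduces to the branch whose guard holds. -/
theorem atom_seq_foldr (hR : IsReducedCongruence R) {J : Type*} (l : List J) (guard : J → BExp T)
    (branch : J → Exp T Act) (e x : Exp T Act) (a : Atom T)
    (hl : ∀ j ∈ l, (guard j).eval a = true →
      R (seq (test (.ofAtom a)) (branch j)) (seq (test (.ofAtom a)) x))
    (he : (∃ j ∈ l, (guard j).eval a = true) ∨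
      R (seq (test (.ofAtom a)) e) (seq (test (.ofAtom a)) x)) :
    R (seq (test (.ofAtom a)) (l.foldr (fun j r => ite (guard j) (branch j) r) e))
      (seq (test (.ofAtom a)) x) := by
  induction l with
  | nil => simpa using he
  | cons j l ih =>
    refine hR.trans (hR.atom_seq_ite _ _ _ _) ?_
    simp only [List.mem_cons, forall_eq_or_imp, exists_eq_or_imp] at hl he
    split_ifs with h
    · exact hl.1 h
    · exact ih hl.2 (by simpa [h] using he)

/-- Coinduction from the uniqueness axiom: two families of programs indexed by the states of a
finite automaton, both compatible with its transitions, coincide. -/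
theorem eq_of_uniqueness (hR : IsReducedCongruence R) (hU : UniquenessAxiom R) {S : Type*}
    [Finite S] (δ : Automaton T Act S) (g h : S → Exp T Act)
    (hg : ∀ s a, R (seq (test (.ofAtom a)) (g s))
      (seq (test (.ofAtom a)) (ofStep ((δ s a).map id (Prod.map id g)))))
    (hh : ∀ s a, R (seq (test (.ofAtom a)) (h s))
      (seq (test (.ofAtom a)) (ofStep ((δ s a).map id (Prod.map id h))))) (s : S) :
    R (g s) (h s) := by
  classical
  -- Each state is duplicated once per atom: the unknown `(s', a)` is used only for transitions to
  -- `s'` along `a`. Thus transitions into the same state with different actions get separate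
  -- coefficients, each a single action.
  obtain ⟨n, ⟨ι⟩⟩ := Finite.exists_equiv_fin (S × Atom T)
  choose accept haccept using fun s => BExp.exists_eval_eq (T := T)
    (fun a => decide (δ s a = .inl true))
  let src (i : Fin n) : S := (ι.symm i).1
  let guard (i j : Fin n) : BExp T :=
    if ∃ p, δ (src i) (ι.symm j).2 = .inr (p, src j) then .ofAtom (ι.symm j).2 else .zero
  have hguard : ∀ i j a, (guard i j).eval a = true ↔
      (ι.symm j).2 = a ∧ ∃ p, δ (src i) a = .inr (p, src j) := by
    intro i j a
    by_cases hp : ∃ p, δ (src i) (ι.symm j).2 = .inr (p, src j)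
    · simp only [guard, if_pos hp, BExp.eval_ofAtom]
      constructor
      · rintro rfl
        exact ⟨rfl, hp⟩
      · rintro ⟨rfl, -⟩
        rfl
    · simp only [guard, if_neg hp, BExp.eval]
      constructor
      · simp
      · rintro ⟨rfl, h⟩
        exact absurd h hp
  -- The value `0` is a productive filler: its guard is then `0` as well.
  let coeff (i j : Fin n) : Exp T Act :=
    match δ (src i) (ι.symm j).2 with
    | .inl _ => .test .zero
    | .inr (p, _) => .act p
  let Sys : AffineSystem T Act n :=
    { coeff := coeff
      guard := guard
      const := fun i => accept (src i)
      guard_disjoint := by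
        intro i j k hjk
        refine BExp.bEquiv_of_eval fun a => ?_
        simp only [BExp.eval]
        rw [Bool.eq_false_iff, ne_eq, Bool.and_eq_true, hguard, hguard]
        rintro ⟨⟨hj, p, hp⟩, hk, q, hq⟩
        rw [hp] at hq
        simp only [Sum.inr.injEq, Prod.mk.injEq] at hq
        exact hjk (ι.symm.injective (Prod.ext hq.2 (hj.trans hk.symm)))
      const_disjoint := by
        intro i j
        refine BExp.bEquiv_of_eval fun a => ?_
        simp only [BExp.eval]
        rw [Bool.eq_false_iff, ne_eq, Bool.and_eq_true, hguard, haccept]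
        rintro ⟨h1, -, p, hp⟩
        simp [hp] at h1 }
  have hSys : Sys.IsSalomaa := by
    intro i j
    change (coeff i j).Productive
    simp only [coeff]
    split <;> exact .refl _
  have sol : ∀ k : S → Exp T Act, (∀ s a, R (seq (test (.ofAtom a)) (k s))
      (seq (test (.ofAtom a)) (ofStep ((δ s a).map id (Prod.map id k))))) →
      Sys.IsSolution R (fun i => k (src i)) := by
    intro k hk i
    refine hR.of_forall_atom fun a => hR.trans (hk (src i) a) (hR.symm ?_)
    refine hR.atom_seq_foldr _ (guard i) _ _ _ a ?_ ?_
    · intro j _ hj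
      obtain ⟨rfl, p, hp⟩ := (hguard i j a).1 hj
      have : Sys.coeff i j = .act p := by simp only [Sys, coeff, hp]
      rw [hp, this]
      exact hR.refl _
    -- At a leaf the cascade falls through to the constant, which holds exactly at accepting atoms.
    -- At an action some guard holds, so the constant does not matter.
    · rcases hs : δ (src i) a with o | ⟨p, s'⟩
      · refine .inr (hR.trans (hR.atom_seq_test _ _) ?_)
        change R (seq _ (test (if (accept (src i)).eval a then _ else _))) _
        rw [haccept, hs]
        cases o <;> exact hR.refl _
      · refine .inl ⟨ι (s', a), List.mem_finRange _, ?_⟩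
        rw [hguard]
        simp [src, hs]
  -- Any atom would do: all copies of `s` carry the same program.
  have key := hU n Sys hSys _ _ (sol g hg) (sol h hh) (ι (s, fun _ => true))
  simpa [src] using key

end IsReducedCongruence

/-! ### Dead trees -/

theorem Tree.Dead.of_step {T Act : Type*} {t t' : Tree T Act} (ht : t.Dead) {a : Atom T} {p : Act}
    (h : t.step a = .inr (p, t')) : t'.Dead := by
  intro w hw
  rcases hh : t.head a with o | q
  · simp [step_of_head_inl hh] at h
  · rw [step_of_head_inr hh] at h
    obtain ⟨rfl, rfl⟩ : q = p ∧ t.deriv a q hh = t' := by simpa using h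
    rcases w with _ | ⟨b, w⟩
    · simp [deriv] at hw
    · exact ht (a :: b :: w) (by simpa [deriv] using hw)

theorem Tree.Dead.step_ne {T Act : Type*} {t : Tree T Act} (ht : t.Dead) (a : Atom T) :
    t.step a ≠ .inl true := by
  intro h
  rcases hh : t.head a with o | q
  · rw [step_of_head_inl hh] at h
    exact ht [a] (by rw [val_singleton, hh]; simpa using h)
  · simp [step_of_head_inr hh] at h

/-! ### Pruning and completeness -/

namespace IsCongruence

open Exp

variable {T Act : Type*} [Fintype T] {R : Exp T Act → Exp T Act → Prop}

/-- Programs without successful termination are equivalent to `0`. -/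
theorem zero_of_dead (hR : IsCongruence R) (hU : UniquenessAxiom R) {e : Exp T Act}
    (he : e.sem.Dead) : R e (test .zero) := by
  obtain ⟨C, hC, heC, hstep⟩ := e.exists_finite_closed
  let S := {f : Exp T Act // f ∈ C ∧ f.sem.Dead}
  have : Finite S := (hC.subset fun f (hf : f ∈ C ∧ f.sem.Dead) => hf.1).to_subtype
  have htrans : ∀ (s : S) (a : Atom T), ∃ x : Bool ⊕ Act × S,
      s.1.step a = x.map id (Prod.map id Subtype.val) ∧ x ≠ .inl true := by
    intro s a
    have hsem := s.1.step_sem a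
    rcases hs : s.1.step a with o | ⟨p, f⟩
    · refine ⟨.inl o, rfl, ?_⟩
      rintro ⟨⟩
      exact s.2.2.step_ne a (by simp [hsem, hs])
    · refine ⟨.inr (p, ⟨f, hstep _ s.2.1 a p f hs, s.2.2.of_step (a := a) (p := p) ?_⟩), rfl,
        by simp⟩
      simp [hsem, hs]
  choose δ hδ hne using htrans
  -- Since no transition accepts, the constant family `0` only has to satisfy `0 ≡ 0` at rejection
  -- and `0 ≡ p · 0` at actions; the latter is `S3`.
  refine hR.eq_of_uniqueness hU δ Subtype.val (fun _ => test .zero) (fun s a => ?_)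
    (fun s a => ?_) (⟨e, heC, he⟩ : S)
  · rw [← hδ]
    exact hR.atom_seq_ofStep _ _
  · rcases hs : δ s a with (_ | _) | ⟨p, s'⟩
    · exact hR.refl _
    · exact absurd hs (hne s a)
    · exact hR.seq_congr (hR.refl _) (hR.symm (hR.S3 _))

/-- At every atom, a program is determined by the root of its normalized semantics. -/
theorem atom_seq_of_normSem (hR : IsCongruence R) (hU : UniquenessAxiom R) (e : Exp T Act)
    (a : Atom T) :
    (∃ o, e.normSem.step a = .inl o ∧
      R (seq (test (.ofAtom a)) e) (seq (test (.ofAtom a)) (ofStep (.inl o)))) ∨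
    ∃ p e', e.step a = .inr (p, e') ∧ e.normSem.step a = .inr (p, e'.normSem) ∧
      R (seq (test (.ofAtom a)) e) (seq (test (.ofAtom a)) (ofStep (.inr (p, e')))) := by
  have hfund := hR.atom_seq_ofStep e a
  have hsem := e.step_sem a
  have hnorm : e.normSem.step a = _ := Tree.step_norm e.sem a
  rcases he : e.step a with o | ⟨p, e'⟩ <;> rw [he] at hfund hsem <;> rw [hsem] at hnorm
  · exact .inl ⟨o, hnorm, hfund⟩
  -- If the derivative is dead, `p · e'` is equivalent to `p · 0` and so to `0`, which is the label
  -- after pruning.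
  · by_cases hd : e'.sem.Dead
    · refine .inl ⟨false, by simpa [hd] using hnorm, hR.trans hfund ?_⟩
      exact hR.seq_congr (hR.refl _)
        (hR.trans (hR.seq_congr (hR.refl _) (hR.zero_of_dead hU hd)) (hR.S3 _))
    · exact .inr ⟨p, e', rfl, by simpa [hd, normSem] using hnorm, hfund⟩

/-- Completeness of the uniqueness axiom for the normalized semantics. -/
theorem of_normSem_eq (hR : IsCongruence R) (hU : UniquenessAxiom R) {e f : Exp T Act}
    (h : e.normSem = f.normSem) : R e f := by
  obtain ⟨C, hC, heC, hstepC⟩ := e.exists_finite_closed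
  obtain ⟨D, hD, hfD, hstepD⟩ := f.exists_finite_closed
  let S := {x : Exp T Act × Exp T Act // x ∈ C ×ˢ D ∧ x.1.normSem = x.2.normSem}
  have : Finite S := ((hC.prod hD).subset
    fun x (hx : x ∈ C ×ˢ D ∧ x.1.normSem = x.2.normSem) => hx.1).to_subtype
  -- The transitions of a pair are read off the normalized trees, since the raw derivatives may
  -- differ: a dead branch of one program may be an outright rejection in the other.
  have htrans : ∀ (s : S) (a : Atom T), ∃ x : Bool ⊕ Act × S,
      R (seq (test (.ofAtom a)) s.1.1)
        (seq (test (.ofAtom a)) (ofStep (x.map id (Prod.map id fun s => s.1.1)))) ∧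
      R (seq (test (.ofAtom a)) s.1.2)
        (seq (test (.ofAtom a)) (ofStep (x.map id (Prod.map id fun s => s.1.2)))) := by
    rintro ⟨⟨e, f⟩, ⟨he, hf⟩, hs : e.normSem = f.normSem⟩ a
    rcases hR.atom_seq_of_normSem hU e a with ⟨o, h1, h2⟩ | ⟨p, e', h0, h1, h2⟩ <;>
      -- Equal normalized trees have equal roots, which excludes the mixed cases. For two actions,
      -- the subtrees agree, so the pair of derivatives is again a state.
      rcases hR.atom_seq_of_normSem hU f a with ⟨o', k1, k2⟩ | ⟨q, f', k0, k1, k2⟩ <;>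
      rw [hs, k1] at h1
    · obtain rfl : o' = o := by simpa using h1
      exact ⟨.inl o', h2, k2⟩
    · simp at h1
    · simp at h1
    · obtain ⟨rfl, hn⟩ : q = p ∧ f'.normSem = e'.normSem := by simpa using h1
      exact ⟨.inr (q, ⟨(e', f'), ⟨hstepC _ he _ _ _ h0, hstepD _ hf _ _ _ k0⟩, hn.symm⟩), h2, k2⟩
  choose δ hδ hδ' using htrans
  exact hR.eq_of_uniqueness hU δ (fun s => s.1.1) (fun s => s.1.2) hδ hδ'
    (⟨(e, f), ⟨heC, hfD⟩, h⟩ : S)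

end IsCongruence

end GKAT

/-! ### Main theorem; the first claim is the second one for the least congruence -/

theorem mainTheorem1 (T Act : Type*) [Finite T] [Finite Act] :
    (GKAT.UniquenessAxiom (GKAT.Equiv (T := T) (Act := Act)) →
      GKAT.UniquenessAxiom (GKAT.Equiv₀ (T := T) (Act := Act)) →
      ∀ e f : GKAT.Exp T Act, e.normSem = f.normSem → GKAT.Equiv e f) ∧
    (∀ R : GKAT.Exp T Act → GKAT.Exp T Act → Prop,
      GKAT.IsCongruence R → GKAT.UniquenessAxiom R →
      ∀ e f : GKAT.Exp T Act, e.normSem = f.normSem → R e f) := by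
  have := Fintype.ofFinite T
  exact ⟨fun hU _ _ _ h => GKAT.isCongruence_equiv.of_normSem_eq hU h,
    fun _ hR hU _ _ h => hR.of_normSem_eq hU h⟩
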